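/- Let $V$ be a valuation domain with field of fractions $K$ and maximal ideal $\mathfrak m$, and let \[ \operatorname{Int}^{\mathrm R}(V) = \{\varphi \in K(x) \mid \varphi(V) \subseteq V\} \] be the ring of integer-valued rational functions over $V$ (the condition $\varphi(V)\subseteq V$ includes that $\varphi$ has no pole in $V$). Then $\operatorname{Int}^{\mathrm R}(V)$ is a Prüfer domain (an integral domain in which every nonzero finitely generated ideal is invertible) if and only if the residue field $V/\mathfrak m$ is not algebraically closed or $\mathfrak m$ is a principal ideal of $V$. -/

import Mathlib

/-- The ring `Int^R(D)` of integer-valued rational functions over a domain `D` with field of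
fractions `K`: the rational functions `φ ∈ K(x)` with `φ(D) ⊆ D`. In particular `φ` has no pole
in `D`: the denominator of `φ` in lowest terms does not vanish at any `d ∈ D`. -/
noncomputable def IntR (D K : Type*) [CommRing D] [IsDomain D] [Field K] [Algebra D K]
    [IsFractionRing D K] : Subring (RatFunc K) where
  carrier := {φ | ∀ d : D, φ.denom.eval (algebraMap D K d) ≠ 0 ∧
    ∃ c : D, φ.eval (RingHom.id K) (algebraMap D K d) = algebraMap D K c}
  mul_mem' := by
    intro φ ψ hφ hψ d
    obtain ⟨h1, a, ha⟩ := hφ d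
    obtain ⟨h2, b, hb⟩ := hψ d
    refine ⟨fun h => ?_, a * b, ?_⟩
    · have := Polynomial.eval_eq_zero_of_dvd_of_eval_eq_zero (RatFunc.denom_mul_dvd φ ψ) h
      rw [Polynomial.eval_mul] at this
      exact (mul_ne_zero h1 h2) this
    · rw [RatFunc.eval_mul (RingHom.id K) _ h1 h2, ha, hb, map_mul]
  one_mem' := fun d => ⟨by simp, 1, by simp⟩
  add_mem' := by
    intro φ ψ hφ hψ d
    obtain ⟨h1, a, ha⟩ := hφ d
    obtain ⟨h2, b, hb⟩ := hψ d
    refine ⟨fun h => ?_, a + b, ?_⟩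
    · have := Polynomial.eval_eq_zero_of_dvd_of_eval_eq_zero (RatFunc.denom_add_dvd φ ψ) h
      rw [Polynomial.eval_mul] at this
      exact (mul_ne_zero h1 h2) this
    · rw [RatFunc.eval_add (RingHom.id K) _ h1 h2, ha, hb, map_add]
  zero_mem' := fun d => ⟨by simp, 0, by simp⟩
  neg_mem' := by
    intro φ hφ d
    obtain ⟨h1, a, ha⟩ := hφ d
    have hC : -φ = RatFunc.C (-1) * φ := by simp
    have h0 : (RatFunc.C (-1 : K)).denom.eval (algebraMap D K d) ≠ 0 := by
      rw [RatFunc.denom_C]; simp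
    refine ⟨fun h => ?_, -a, ?_⟩
    · rw [hC] at h
      have := Polynomial.eval_eq_zero_of_dvd_of_eval_eq_zero (RatFunc.denom_mul_dvd _ φ) h
      rw [Polynomial.eval_mul] at this
      exact (mul_ne_zero h0 h1) this
    · rw [hC, RatFunc.eval_mul (RingHom.id K) _ h0 h1, ha, RatFunc.eval_C]
      simp

/-- A Prüfer domain: an integral domain in which every nonzero finitely generated ideal is
invertible, as a fractional ideal of the field of fractions. -/
structure IsPruferDomain (R : Type*) [CommRing R] : Prop where
  isDomain : IsDomain R
  isUnit_of_fg : ∀ I : Ideal R, I ≠ ⊥ → I.FG →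
    IsUnit (I : FractionalIdeal (nonZeroDivisors R) (FractionRing R))

/-! `IntR V K` is the intersection over `d : V` of the valuation rings V_d of those φ with φ(d) ∈ V.
For sufficiency it is enough to write 1 = e₁w + e₂ for each quotient w, with e₁, e₂, e₁w, e₂w in
every V_d (`Subring.isPruferDomain_of_exists`). If f is monic over V and has no root in the residue
field, split f(w)/f(w) into its part divisible by w and its constant part. If 𝔪 = (t) with t ≠ 0, do
the same with w² - t. If V is a field, use Bézout in K[x].

For necessity, let 𝔪 be non-principal and the residue field algebraically closed. If (x, t) is
invertible, some φ satisfies tφ = xψ₁ and x(1 - φ) = tψ₂, so φ(ty) is a non-unit for y ∈ 𝔪 and a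
unit for y⁻¹ ∈ 𝔪. Write φ(ty) = (α/β) f(y)/g(y) with f, g primitive. When s has value close to that
of a unit, f(a + s) is a unit times s to the multiplicity of a in the reduction of f, and f(1/s) is
a unit times s to minus the degree of that reduction. Hence α/β is a unit, the two reductions have
equal degree, and every root multiplicity for f is at least that for g, strictly at 0. Over an
algebraically closed field multiplicities sum to the degree, a contradiction
(`ValuationRing.false_of_eval_quotient`). -/

/-! ### Invertible ideals and criteria for Prüfer domains -/

/-- An ideal of a domain is invertible iff it divides a nonzero principal ideal. -/
theorem Ideal.isUnit_fractionalIdeal_iff {R : Type*} [CommRing R] [IsDomain R] (I : Ideal R) :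
    IsUnit (I : FractionalIdeal (nonZeroDivisors R) (FractionRing R)) ↔
      ∃ (J : Ideal R) (r : R), r ≠ 0 ∧ I * J = Ideal.span {r} := by
  constructor
  · rintro ⟨u, hu⟩
    obtain ⟨r, J, hr, hJ⟩ := FractionalIdeal.exists_eq_spanSingleton_mul
      (↑u⁻¹ : FractionalIdeal (nonZeroDivisors R) (FractionRing R))
    refine ⟨J, r, hr, ?_⟩
    have hr' : algebraMap R (FractionRing R) r ≠ 0 := by
      simpa using hr
    have h1 : (I : FractionalIdeal (nonZeroDivisors R) (FractionRing R)) * ↑u⁻¹ = 1 := by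
      rw [← hu, Units.mul_inv]
    rw [hJ] at h1
    apply FractionalIdeal.coeIdeal_injective (K := FractionRing R)
    simp only [FractionalIdeal.coeIdeal_mul, FractionalIdeal.coeIdeal_span_singleton]
    have h2 : FractionalIdeal.spanSingleton (nonZeroDivisors R) (algebraMap R (FractionRing R) r) *
        FractionalIdeal.spanSingleton (nonZeroDivisors R)
          (algebraMap R (FractionRing R) r)⁻¹ = 1 := by
      rw [FractionalIdeal.spanSingleton_mul_spanSingleton, mul_inv_cancel₀ hr',
        FractionalIdeal.spanSingleton_one]
    calc (I : FractionalIdeal (nonZeroDivisors R) (FractionRing R)) * J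
        = (FractionalIdeal.spanSingleton (nonZeroDivisors R) (algebraMap R (FractionRing R) r) *
          FractionalIdeal.spanSingleton (nonZeroDivisors R)
          (algebraMap R (FractionRing R) r)⁻¹) * (I * J) := by rw [h2, one_mul]
      _ = FractionalIdeal.spanSingleton (nonZeroDivisors R) (algebraMap R (FractionRing R) r) *
          (I * (FractionalIdeal.spanSingleton (nonZeroDivisors R)
          (algebraMap R (FractionRing R) r)⁻¹ * J)) := by ring
      _ = _ := by rw [h1, mul_one]
  · rintro ⟨J, r, hr, h⟩
    have hr' : algebraMap R (FractionRing R) r ≠ 0 := by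
      simpa using hr
    have h1 : IsUnit (FractionalIdeal.spanSingleton (nonZeroDivisors R)
        (algebraMap R (FractionRing R) r)) := by
      refine IsUnit.of_mul_eq_one (FractionalIdeal.spanSingleton (nonZeroDivisors R)
          (algebraMap R (FractionRing R) r)⁻¹) ?_
      rw [FractionalIdeal.spanSingleton_mul_spanSingleton, mul_inv_cancel₀ hr',
        FractionalIdeal.spanSingleton_one]
    rw [← FractionalIdeal.coeIdeal_span_singleton, ← h, FractionalIdeal.coeIdeal_mul] at h1
    exact isUnit_of_mul_isUnit_left h1

/-- The polynomial identity has an extra term ABC, which the left side already contains.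
Invertibility of the three pairwise sums therefore passes to A + B + C. -/
theorem Ideal.sup_mul_sup_mul_sup {R : Type*} [CommRing R] (A B C : Ideal R) :
    (A ⊔ B) * (B ⊔ C) * (A ⊔ C) = (A ⊔ B ⊔ C) * (A * B ⊔ B * C ⊔ A * C) := by
  have h : (A ⊔ B) * (B ⊔ C) * (A ⊔ C) + A * B * C =
      (A ⊔ B ⊔ C) * (A * B ⊔ B * C ⊔ A * C) := by
    simp only [← Ideal.add_eq_sup]
    ring
  rw [← h, Ideal.add_eq_sup, left_eq_sup]
  exact Ideal.mul_mono (Ideal.mul_mono le_sup_left le_sup_left) le_sup_right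

/-- A domain whose two-generated ideals are invertible is a Prüfer domain. -/
theorem IsPruferDomain.of_pair {R : Type*} [CommRing R] [IsDomain R]
    (h : ∀ a b : R, a ≠ 0 → b ≠ 0 →
      ∃ (J : Ideal R) (r : R), r ≠ 0 ∧ Ideal.span {a, b} * J = Ideal.span {r}) :
    IsPruferDomain R := by
  refine ⟨inferInstance, fun I hI hfg => ?_⟩
  have key : ∀ (n : ℕ) (l : List R), l.length = n + 1 → (∀ x ∈ l, x ≠ 0) →
      IsUnit ((Ideal.span {x | x ∈ l} : Ideal R) :
        FractionalIdeal (nonZeroDivisors R) (FractionRing R)) := by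
    intro n
    induction n with
    | zero =>
      intro l hl h0
      obtain ⟨a, rfl⟩ := List.length_eq_one_iff.mp hl
      refine (Ideal.isUnit_fractionalIdeal_iff _).mpr ⟨⊤, a, h0 a (by simp), ?_⟩
      simp
    | succ n ih =>
      intro l hl h0
      match l, hl, h0 with
      | a :: c :: l, hl, h0 =>
        have hset : ∀ (x : R) (l : List R), Ideal.span {y | y ∈ x :: l} =
            Ideal.span {x} ⊔ Ideal.span {y | y ∈ l} := by
          intro x l
          rw [← Ideal.span_union]
          congr 1
          ext y
          simp
        have h1 := ih (a :: l) (by simpa using hl) (by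
          intro x hx; apply h0; simp at hx ⊢; tauto)
        have h2 := ih (c :: l) (by simpa using hl) (by
          intro x hx; apply h0; simp at hx ⊢; tauto)
        have h3 := (Ideal.isUnit_fractionalIdeal_iff _).mpr
          (h a c (h0 a (by simp)) (h0 c (by simp)))
        rw [Ideal.span_insert] at h3
        rw [hset] at h1 h2
        rw [sup_comm] at h2
        have h4 := (h1.mul h2).mul h3
        rw [← FractionalIdeal.coeIdeal_mul, ← FractionalIdeal.coeIdeal_mul,
          Ideal.sup_mul_sup_mul_sup, FractionalIdeal.coeIdeal_mul] at h4
        have h5 := isUnit_of_mul_isUnit_left h4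
        rw [hset, hset, sup_comm (Ideal.span {c}), ← sup_assoc]
        exact h5
  classical
  obtain ⟨s, rfl⟩ := hfg
  -- The hypothesis covers only nonzero pairs, so zero generators are dropped.
  have hs : Ideal.span (s : Set R) = Ideal.span {x | x ∈ (s.erase 0).toList} := by
    have : {x | x ∈ (s.erase 0).toList} = (s : Set R) \ {0} := by
      ext x; simp [and_comm]
    rw [this, Ideal.span_sdiff_singleton_zero]
  have hne : (s.erase 0).toList.length ≠ 0 := by
    intro h0
    apply hI
    have h1 := List.eq_nil_of_length_eq_zero h0
    change Ideal.span (s : Set R) = ⊥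
    rw [hs, h1]
    simp
  obtain ⟨n, hn⟩ := Nat.exists_eq_succ_of_ne_zero hne
  have := key n _ hn (fun x hx => (Finset.mem_erase.mp (Finset.mem_toList.mp hx)).1)
  rw [← hs] at this
  exact this

/-- A subring of a field is Prüfer if every quotient `w` of two of its elements admits an
expression `e₁ w + e₂ = 1` in which `e₁`, `e₂`, `e₁ w` and `e₂ w` lie in the subring. -/
theorem Subring.isPruferDomain_of_exists {L : Type*} [Field L] (R : Subring L)
    (h : ∀ a b : L, a ∈ R → b ∈ R → a ≠ 0 → b ≠ 0 → ∃ e₁ e₂ : L, e₁ * (a / b) + e₂ = 1 ∧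
      e₁ ∈ R ∧ e₂ ∈ R ∧ e₁ * (a / b) ∈ R ∧ e₂ * (a / b) ∈ R) :
    IsPruferDomain R := by
  refine IsPruferDomain.of_pair fun a b ha hb => ?_
  have ha' : (a : L) ≠ 0 := by simpa using ha
  have hb' : (b : L) ≠ 0 := by simpa using hb
  obtain ⟨e₁, e₂, h0, h1, h2, h3, h4⟩ := h a b a.2 b.2 ha' hb'
  let f₁ : R := ⟨e₁ * (a / b), h3⟩
  let f₂ : R := ⟨e₂ * (a / b), h4⟩
  let g₁ : R := ⟨e₁, h1⟩
  let g₂ : R := ⟨e₂, h2⟩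
  have e2 : b * f₁ = a * g₁ := by
    apply Subtype.ext
    simp only [f₁, g₁, Subring.coe_mul]
    field_simp
  have e3 : b * f₂ = a * g₂ := by
    apply Subtype.ext
    simp only [f₂, g₂, Subring.coe_mul]
    field_simp
  have e4 : f₁ + g₂ = 1 := Subtype.ext h0
  -- With w = a/b the cofactor is (e₁w, e₂w): here b·e₁w = a·e₁ and b·e₂w = a·e₂, while a = a·e₁w +
  -- b·e₂w.
  refine ⟨Ideal.span {f₁, f₂}, a, ha, ?_⟩
  rw [Ideal.span_pair_mul_span_pair]
  apply le_antisymm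
  · rw [Ideal.span_le]
    rintro x (rfl | rfl | rfl | rfl) <;>
      rw [SetLike.mem_coe, Ideal.mem_span_singleton]
    · exact ⟨_, rfl⟩
    · exact ⟨_, rfl⟩
    · exact ⟨_, e2⟩
    · exact ⟨_, e3⟩
  · rw [Ideal.span_singleton_le_iff_mem]
    have : a = a * f₁ + b * f₂ := by
      rw [e3, ← mul_add, e4, mul_one]
    have hm : a * f₁ + b * f₂ ∈ Ideal.span {a * f₁, a * f₂, b * f₁, b * f₂} :=
      add_mem (Ideal.subset_span (Or.inl rfl))
        (Ideal.subset_span (Or.inr (Or.inr (Or.inr rfl))))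
    rwa [← this] at hm

/-- Invertibility of a two-generated ideal in terms of elements. -/
theorem Ideal.exists_of_isUnit_span_pair {R : Type*} [CommRing R] [IsDomain R] {a b : R}
    (h : IsUnit ((Ideal.span {a, b} : Ideal R) :
      FractionalIdeal (nonZeroDivisors R) (FractionRing R))) :
    ∃ φ ψ₁ ψ₂ : R, b * φ = a * ψ₁ ∧ a * (1 - φ) = b * ψ₂ := by
  obtain ⟨J, r, hr, h⟩ := (Ideal.isUnit_fractionalIdeal_iff _).mp h
  have hmem : ∀ x ∈ Ideal.span {a, b}, ∀ j ∈ J, ∃ y, x * j = r * y := by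
    intro x hx j hj
    have := Ideal.mul_mem_mul hx hj
    rw [h] at this
    exact Ideal.mem_span_singleton.mp this
  have hrm : r ∈ Ideal.span {a, b} * J := by
    rw [h]; exact Ideal.mem_span_singleton_self r
  rw [Ideal.span_insert, Ideal.sup_mul, Submodule.mem_sup] at hrm
  obtain ⟨y, hy, z, hz, hyz⟩ := hrm
  obtain ⟨j, hj, rfl⟩ := Ideal.mem_span_singleton_mul.mp hy
  obtain ⟨k, hk, rfl⟩ := Ideal.mem_span_singleton_mul.mp hz
  have ha : a ∈ Ideal.span {a, b} := Ideal.subset_span (by simp)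
  have hb : b ∈ Ideal.span {a, b} := Ideal.subset_span (by simp)
  -- With r = aj + bk, the witnesses are φ = aj/r, ψ₁ = bj/r, ψ₂ = ak/r, and 1 - φ = bk/r.
  obtain ⟨φ, h1⟩ := hmem a ha j hj
  obtain ⟨ψ₁, h2⟩ := hmem b hb j hj
  obtain ⟨ψ₂, h3⟩ := hmem a ha k hk
  refine ⟨φ, ψ₁, ψ₂, mul_left_cancel₀ hr ?_, mul_left_cancel₀ hr ?_⟩
  · linear_combination a * h2 - b * h1
  · linear_combination b * h3 + a * h1 - a * hyz

/-! ### Values of polynomials under a valuation -/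

open Polynomial in
theorem Polynomial.eval₂_eq_coeff_zero_add {R S : Type*} [CommSemiring R] [CommSemiring S]
    (ι : R →+* S) (p : R[X]) (z : S) :
    p.eval₂ ι z = ι (p.coeff 0) + z * p.divX.eval₂ ι z := by
  conv_lhs => rw [← p.divX_mul_X_add]
  rw [eval₂_add, eval₂_C, eval₂_mul, eval₂_X]
  ring

namespace Valuation

open Polynomial

variable {V L Γ : Type*} [CommRing V] [Field L] [LinearOrderedCommGroupWithZero Γ]
  (v : Valuation L Γ) (ι : V →+* L)

theorem eval₂_le_one (hι : ∀ c, v (ι c) ≤ 1) (p : V[X]) {u : L} (hu : v u ≤ 1) :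
    v (p.eval₂ ι u) ≤ 1 := by
  rw [eval₂_eq_sum]
  refine v.map_sum_le fun i _ => ?_
  rw [map_mul, map_pow]
  exact mul_le_one' (hι _) (pow_le_one' hu i)

/-- Expanding p around c shows that p(u) and p(c) differ by an element of value below 1. -/
theorem eval₂_eq_one_of_isUnit (hι : ∀ c, v (ι c) ≤ 1) {p : V[X]} {c : V}
    (hp : IsUnit (p.eval c)) {u : L} (hu : v (u - ι c) < 1) : v (p.eval₂ ι u) = 1 := by
  have h1 : p.eval₂ ι u = (p.comp (X + C c)).eval₂ ι (u - ι c) := by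
    rw [eval₂_comp]; simp
  have h2 : (p.comp (X + C c)).coeff 0 = p.eval c := by
    rw [coeff_zero_eq_eval_zero, eval_comp]; simp
  have h3 : v (ι (p.eval c)) = 1 := by
    obtain ⟨w, hw⟩ := hp
    refine le_antisymm (hι _) ?_
    have h := hι (↑w⁻¹ : V)
    have h4 : v (ι (p.eval c)) * v (ι ↑w⁻¹) = 1 := by
      rw [← map_mul, ← map_mul, ← hw, Units.mul_inv, map_one, map_one]
    calc (1 : Γ) = v (ι (p.eval c)) * v (ι ↑w⁻¹) := h4.symm
      _ ≤ v (ι (p.eval c)) * 1 := by gcongr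
      _ = _ := mul_one _
  rw [h1, eval₂_eq_coeff_zero_add, h2, v.map_add_eq_of_lt_left, h3]
  rw [h3, map_mul]
  exact mul_lt_one_of_lt_of_le hu (eval₂_le_one v ι hι _ hu.le)

/-- If a monic polynomial takes unit values on the valuation ring, then quotients by it of
polynomials of no larger degree take values in the valuation ring on the whole field. -/
theorem eval₂_div_eval₂_le_one (hι : ∀ c, v (ι c) ≤ 1) {f p : V[X]} (hf : f.Monic)
    (hpf : p.natDegree ≤ f.natDegree) (hu : ∀ u : L, v u ≤ 1 → v (f.eval₂ ι u) = 1) (w : L) :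
    f.eval₂ ι w ≠ 0 ∧ v (p.eval₂ ι w / f.eval₂ ι w) ≤ 1 := by
  by_cases hw : v w ≤ 1
  · have h := hu w hw
    refine ⟨fun h0 => by simp [h0] at h, ?_⟩
    rw [map_div₀, h, div_one]
    exact eval₂_le_one v ι hι p hw
  · rw [not_le] at hw
    have hw0 : w ≠ 0 := by rintro rfl; simp at hw
    have hz : v w⁻¹ < 1 := by
      rw [map_inv₀]; exact inv_lt_one_of_one_lt₀ hw
    -- Outside the valuation ring, pass to reversed polynomials at w⁻¹. Since f is monic, its
    -- reversal has constant term 1 and so has value 1 there.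
    let := invertibleOfNonzero hw0
    have h1 := eval₂_reflect_mul_pow ι w f.natDegree f le_rfl
    have h2 := eval₂_reflect_mul_pow ι w f.natDegree p hpf
    rw [invOf_eq_inv] at h1 h2
    have h3 : v ((reflect f.natDegree f).eval₂ ι w⁻¹) = 1 := by
      have h0 : (reflect f.natDegree f).coeff 0 = 1 := by
        rw [coeff_reflect, revAt_zero]
        exact hf
      rw [eval₂_eq_coeff_zero_add, h0, map_one]
      apply v.map_one_add_of_lt
      rw [map_mul]
      exact mul_lt_one_of_lt_of_le hz (eval₂_le_one v ι hι _ hz.le)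
    have h4 : (reflect f.natDegree f).eval₂ ι w⁻¹ ≠ 0 := fun h0 => by simp [h0] at h3
    refine ⟨?_, ?_⟩
    · rw [← h1]
      exact mul_ne_zero h4 (pow_ne_zero _ hw0)
    · rw [← h1, ← h2, mul_div_mul_right _ _ (pow_ne_zero _ hw0), map_div₀, h3, div_one]
      exact eval₂_le_one v ι hι _ hz.le

/-- When `t` has the largest value below `1`, the quadratic form `x² - t y²` represents only
elements of controlled value. -/
theorem sq_sub_generator {t : L} (ht1 : v t < 1) (ht0 : t ≠ 0)
    (ht : ∀ x, v x < 1 → v x ≤ v t) (w : L) :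
    w ^ 2 - t ≠ 0 ∧ v (w / (w ^ 2 - t)) ≤ 1 ∧ v (-t / (w ^ 2 - t)) ≤ 1 ∧
      v (w / (w ^ 2 - t) * w) ≤ 1 ∧ v (-t / (w ^ 2 - t) * w) ≤ 1 := by
  have hvt : v t ≠ 0 := (v.ne_zero_iff).mpr ht0
  have key : v (w ^ 2 - t) ≠ 0 → v w ≤ v (w ^ 2 - t) → v t ≤ v (w ^ 2 - t) →
      v w * v w ≤ v (w ^ 2 - t) → v t * v w ≤ v (w ^ 2 - t) →
    w ^ 2 - t ≠ 0 ∧ v (w / (w ^ 2 - t)) ≤ 1 ∧ v (-t / (w ^ 2 - t)) ≤ 1 ∧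
      v (w / (w ^ 2 - t) * w) ≤ 1 ∧ v (-t / (w ^ 2 - t) * w) ≤ 1 := by
    intro h0 h1 h2 h3 h4
    have hpos : 0 < v (w ^ 2 - t) := zero_lt_iff.mpr h0
    refine ⟨(v.ne_zero_iff).mp h0, ?_, ?_, ?_, ?_⟩
    · rwa [map_div₀, div_le_one₀ hpos]
    · rwa [map_div₀, map_neg, div_le_one₀ hpos]
    · rwa [div_mul_eq_mul_div, map_div₀, map_mul, div_le_one₀ hpos]
    · rwa [div_mul_eq_mul_div, map_div₀, map_mul, map_neg, div_le_one₀ hpos]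
  -- If v w < 1, then v w ≤ v t and the term t dominates w²; otherwise w² dominates.
  rcases lt_or_ge (v w) 1 with h | h
  · have hw := ht w h
    have h5 : v (w ^ 2) < v t := by
      rw [map_pow, pow_two]
      calc v w * v w ≤ v t * v w := by gcongr
        _ < v t * 1 := mul_lt_mul_of_pos_left h (zero_lt_iff.mpr hvt)
        _ = v t := mul_one _
    have h6 : v (w ^ 2 - t) = v t := v.map_sub_eq_of_lt_right h5
    apply key <;> rw [h6]
    · exact hvt
    · exact hw
    · rw [← pow_two, ← map_pow]; exact h5.le
    · exact mul_le_of_le_one_right' h.le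
  · have h7 : v w ≤ v w * v w := le_mul_of_one_le_right' h
    have h6 : v (w ^ 2 - t) = v w * v w := by
      rw [← pow_two, ← map_pow]
      apply v.map_sub_eq_of_lt_left
      rw [map_pow, pow_two]
      exact ht1.trans_le (h.trans h7)
    apply key <;> rw [h6]
    · exact (zero_lt_one.trans_le (h.trans h7)).ne'
    · exact h7
    · exact ht1.le.trans (h.trans h7)
    · exact mul_le_mul_left (ht1.le.trans h) _

end Valuation

/-! ### Evaluation of rational functions and the valuation ring at a point -/

namespace RatFunc

open Polynomial

variable {K : Type*} [Field K]

theorem eval_denom_mul_ne_zero {φ ψ : RatFunc K} {d : K} (h1 : φ.denom.eval d ≠ 0)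
    (h2 : ψ.denom.eval d ≠ 0) : (φ * ψ).denom.eval d ≠ 0 := by
  intro h
  have := eval_eq_zero_of_dvd_of_eval_eq_zero (denom_mul_dvd φ ψ) h
  rw [Polynomial.eval_mul] at this
  exact (mul_ne_zero h1 h2) this

theorem eval_denom_add_ne_zero {φ ψ : RatFunc K} {d : K} (h1 : φ.denom.eval d ≠ 0)
    (h2 : ψ.denom.eval d ≠ 0) : (φ + ψ).denom.eval d ≠ 0 := by
  intro h
  have := eval_eq_zero_of_dvd_of_eval_eq_zero (denom_add_dvd φ ψ) h
  rw [Polynomial.eval_mul] at this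
  exact (mul_ne_zero h1 h2) this

theorem eval_div_of_ne_zero {p q : K[X]} {d : K} (hq : q.eval d ≠ 0) :
    (algebraMap K[X] (RatFunc K) p / algebraMap K[X] (RatFunc K) q).denom.eval d ≠ 0 ∧
    (algebraMap K[X] (RatFunc K) p / algebraMap K[X] (RatFunc K) q).eval (RingHom.id K) d =
      p.eval d / q.eval d := by
  have h1 : (algebraMap K[X] (RatFunc K) p / algebraMap K[X] (RatFunc K) q).denom.eval d ≠ 0 :=
    fun h => hq (eval_eq_zero_of_dvd_of_eval_eq_zero (denom_div_dvd p q) h)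
  refine ⟨h1, ?_⟩
  have hq0 : algebraMap K[X] (RatFunc K) q ≠ 0 := by
    refine (map_ne_zero_iff _ (IsFractionRing.injective K[X] (RatFunc K))).mpr ?_
    rintro rfl
    simp at hq
  rw [eq_div_iff hq]
  have h2 := eval_mul (RingHom.id K) (a := d)
    (x := algebraMap K[X] (RatFunc K) p / algebraMap K[X] (RatFunc K) q)
    (y := algebraMap K[X] (RatFunc K) q) h1 (by simp)
  rw [div_mul_cancel₀ _ hq0] at h2
  simpa using h2.symm

end RatFunc

namespace IntR

open Polynomial

variable (V K : Type*) [CommRing V] [IsDomain V] [ValuationRing V]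
    [Field K] [Algebra V K] [IsFractionRing V K]

/-- The valuation ring of the rational functions without pole at `d` whose value at `d` is
integral. -/
noncomputable def valuationSubringAt (d : V) : ValuationSubring (RatFunc K) where
  carrier := {φ | φ.denom.eval (algebraMap V K d) ≠ 0 ∧
    ∃ c : V, φ.eval (RingHom.id K) (algebraMap V K d) = algebraMap V K c}
  mul_mem' := by
    rintro φ ψ ⟨h1, a, ha⟩ ⟨h2, b, hb⟩
    exact ⟨RatFunc.eval_denom_mul_ne_zero h1 h2, a * b,
      by rw [RatFunc.eval_mul (RingHom.id K) _ h1 h2, ha, hb, map_mul]⟩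
  one_mem' := ⟨by simp, 1, by simp⟩
  add_mem' := by
    rintro φ ψ ⟨h1, a, ha⟩ ⟨h2, b, hb⟩
    exact ⟨RatFunc.eval_denom_add_ne_zero h1 h2, a + b,
      by rw [RatFunc.eval_add (RingHom.id K) _ h1 h2, ha, hb, map_add]⟩
  zero_mem' := ⟨by simp, 0, by simp⟩
  neg_mem' := by
    rintro φ ⟨h1, a, ha⟩
    have hC : -φ = RatFunc.C (-1) * φ := by simp
    have h0 : (RatFunc.C (-1 : K)).denom.eval (algebraMap V K d) ≠ 0 := by
      rw [RatFunc.denom_C]; simp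
    rw [hC]
    refine ⟨RatFunc.eval_denom_mul_ne_zero h0 h1, -a, ?_⟩
    rw [RatFunc.eval_mul (RingHom.id K) _ h0 h1, ha, RatFunc.eval_C]
    simp
  mem_or_inv_mem' := by
    intro φ
    have hinv : φ⁻¹ = algebraMap K[X] (RatFunc K) φ.denom / algebraMap K[X] (RatFunc K) φ.num := by
      conv_lhs => rw [← RatFunc.num_div_denom φ]
      rw [inv_div]
    by_cases hd : φ.denom.eval (algebraMap V K d) = 0
    -- At a pole the numerator is nonzero by coprimality, so φ⁻¹ vanishes at d.
    · right
      have hn : φ.num.eval (algebraMap V K d) ≠ 0 := by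
        intro hn
        obtain ⟨a, b, hab⟩ := RatFunc.isCoprime_num_denom φ
        have := congrArg (Polynomial.eval (algebraMap V K d)) hab
        simp [hd, hn] at this
      have h := RatFunc.eval_div_of_ne_zero (p := φ.denom) hn
      rw [← hinv, hd, zero_div] at h
      exact ⟨h.1, 0, by rw [h.2, map_zero]⟩
    · have hφ : φ.eval (RingHom.id K) (algebraMap V K d) =
          φ.num.eval (algebraMap V K d) / φ.denom.eval (algebraMap V K d) := rfl
      rcases ValuationRing.isInteger_or_isInteger V
        (φ.eval (RingHom.id K) (algebraMap V K d)) with ⟨c, hc⟩ | ⟨c, hc⟩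
      · exact Or.inl ⟨hd, c, hc.symm⟩
      · by_cases hn : φ.num.eval (algebraMap V K d) = 0
        · left
          exact ⟨hd, 0, by rw [hφ, hn, zero_div, map_zero]⟩
        · right
          have h := RatFunc.eval_div_of_ne_zero (p := φ.denom) hn
          rw [← hinv] at h
          refine ⟨h.1, c, ?_⟩
          rw [h.2, hc, hφ, inv_div]

variable {V K}

theorem C_mem_valuationSubringAt (c d : V) :
    RatFunc.C (algebraMap V K c) ∈ valuationSubringAt V K d :=
  ⟨by simp, c, by simp⟩

/-- Units of the valuation ring at d are detected by evaluation, since φ⁻¹ is integral at d exactly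
when 1/φ(d) makes sense and lies in V. -/
theorem valuation_lt_one_iff {d : V} {φ : RatFunc K} :
    (valuationSubringAt V K d).valuation φ < 1 ↔
      φ.denom.eval (algebraMap V K d) ≠ 0 ∧ ∃ c ∈ IsLocalRing.maximalIdeal V,
        φ.eval (RingHom.id K) (algebraMap V K d) = algebraMap V K c := by
  by_cases h0 : φ = 0
  · subst h0
    simpa using ⟨0, by simp, by simp⟩
  have hinv : (valuationSubringAt V K d).valuation φ < 1 ↔ φ⁻¹ ∉ valuationSubringAt V K d := by
    rw [← ValuationSubring.valuation_le_one_iff, not_le, map_inv₀,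
      one_lt_inv₀ (zero_lt_iff.mpr ((Valuation.ne_zero_iff _).mpr h0))]
  rw [hinv]
  constructor
  · intro h
    obtain ⟨h1, c, hc⟩ := ((valuationSubringAt V K d).mem_or_inv_mem φ).resolve_right h
    refine ⟨h1, c, ?_, hc⟩
    rw [IsLocalRing.mem_maximalIdeal]
    rintro ⟨u, rfl⟩
    apply h
    have hφ : φ.eval (RingHom.id K) (algebraMap V K d) =
          φ.num.eval (algebraMap V K d) / φ.denom.eval (algebraMap V K d) := rfl
    have hn : φ.num.eval (algebraMap V K d) ≠ 0 := by
      intro hn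
      rw [hφ, hn, zero_div] at hc
      exact u.ne_zero (IsFractionRing.injective V K (by rw [map_zero, hc]))
    have h2 := RatFunc.eval_div_of_ne_zero (p := φ.denom) hn
    rw [← inv_div, RatFunc.num_div_denom] at h2
    refine ⟨h2.1, (↑u⁻¹ : V), ?_⟩
    rw [h2.2, ← inv_div, ← hφ, hc]
    exact inv_eq_of_mul_eq_one_right (by rw [← map_mul, Units.mul_inv, map_one])
  · rintro ⟨h1, c, hc, he⟩ ⟨h2, c', he'⟩
    have h := RatFunc.eval_mul (RingHom.id K) _ h1 h2
    rw [mul_inv_cancel₀ h0, he, he', RatFunc.eval_one, ← map_mul, ← map_one (algebraMap V K)] at h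
    have h3 := IsFractionRing.injective V K h
    exact hc (IsUnit.of_mul_eq_one _ h3.symm)

/-- Take c = φ(d). Constants from V thus represent all residue classes, so a polynomial with unit
values on V has unit values on the larger ring. -/
theorem exists_valuation_sub_C_lt_one {d : V} {φ : RatFunc K}
    (h : (valuationSubringAt V K d).valuation φ ≤ 1) :
    ∃ c : V, (valuationSubringAt V K d).valuation (φ - RatFunc.C (algebraMap V K c)) < 1 := by
  obtain ⟨h1, c, hc⟩ := (ValuationSubring.valuation_le_one_iff _ _).mp h
  refine ⟨c, valuation_lt_one_iff.mpr ?_⟩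
  have h2 : (RatFunc.C (algebraMap V K (-c))).denom.eval (algebraMap V K d) ≠ 0 := by
    rw [RatFunc.denom_C]; simp
  rw [sub_eq_add_neg, ← map_neg, ← map_neg]
  refine ⟨RatFunc.eval_denom_add_ne_zero h1 h2, 0, by simp, ?_⟩
  rw [RatFunc.eval_add (RingHom.id K) _ h1 h2, hc, RatFunc.eval_C, RingHom.id_apply, map_neg,
    add_neg_cancel, map_zero]

/-- If φ(d) = tb, then t⁻¹φ takes the value b at d, so t still generates the maximal ideal of the
larger valuation ring. -/
theorem valuation_le_of_maximalIdeal_eq_span {d t : V} (ht0 : t ≠ 0)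
    (ht : IsLocalRing.maximalIdeal V = Ideal.span {t}) {φ : RatFunc K}
    (h : (valuationSubringAt V K d).valuation φ < 1) :
    (valuationSubringAt V K d).valuation φ ≤
      (valuationSubringAt V K d).valuation (RatFunc.C (algebraMap V K t)) := by
  obtain ⟨h1, c, hc, he⟩ := valuation_lt_one_iff.mp h
  rw [ht, Ideal.mem_span_singleton] at hc
  obtain ⟨b, rfl⟩ := hc
  have ht' : algebraMap V K t ≠ 0 :=
    (map_ne_zero_iff _ (IsFractionRing.injective V K)).mpr ht0
  rw [ValuationSubring.valuation_le_iff]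
  have h2 : (RatFunc.C (algebraMap V K t)⁻¹).denom.eval (algebraMap V K d) ≠ 0 := by
    rw [RatFunc.denom_C]; simp
  refine ⟨⟨RatFunc.C (algebraMap V K t)⁻¹ * φ, RatFunc.eval_denom_mul_ne_zero h2 h1, b, ?_⟩, ?_⟩
  · rw [RatFunc.eval_mul (RingHom.id K) _ h2 h1, he, RatFunc.eval_C, RingHom.id_apply, map_mul,
      inv_mul_cancel_left₀ ht']
  · change RatFunc.C (algebraMap V K t)⁻¹ * φ * RatFunc.C (algebraMap V K t) = φ
    rw [mul_right_comm, ← map_mul, inv_mul_cancel₀ ht', map_one, one_mul]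

/-! ### Sufficiency of each condition -/

theorem isPruferDomain_of_not_isAlgClosed (h : ¬ IsAlgClosed (IsLocalRing.ResidueField V)) :
    IsPruferDomain (IntR V K) := by
  obtain ⟨g, hg, hirr, hroot⟩ : ∃ g : (IsLocalRing.ResidueField V)[X], g.Monic ∧
      Irreducible g ∧ ∀ x, g.eval x ≠ 0 := by
    by_contra! hcon
    exact h (IsAlgClosed.of_exists_root _ hcon)
  have hl : g ∈ lifts (IsLocalRing.residue V) := by
    rw [lifts_iff_coeff_lifts]
    exact fun n => IsLocalRing.residue_surjective _
  obtain ⟨f, rfl, hdeg, hf⟩ := lifts_and_natDegree_eq_and_monic hl hg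
  have hpos : 0 < f.natDegree := hdeg ▸ hirr.natDegree_pos
  have hunit : ∀ c : V, IsUnit (f.eval c) := by
    intro c
    by_contra hc
    apply hroot (IsLocalRing.residue V c)
    rw [eval_map, eval₂_at_apply, IsLocalRing.residue_eq_zero_iff]
    exact hc
  let ι : V →+* RatFunc K := RatFunc.C.comp (algebraMap V K)
  have hι : ∀ d c : V, (valuationSubringAt V K d).valuation (ι c) ≤ 1 := fun d c =>
    (ValuationSubring.valuation_le_one_iff _ _).mpr (C_mem_valuationSubringAt c d)
  have hval : ∀ (d : V) (u : RatFunc K), (valuationSubringAt V K d).valuation u ≤ 1 →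
      (valuationSubringAt V K d).valuation (f.eval₂ ι u) = 1 := by
    intro d u hu
    obtain ⟨c, hc⟩ := exists_valuation_sub_C_lt_one hu
    exact Valuation.eval₂_eq_one_of_isUnit _ ι (hι d) (hunit c) hc
  have hmem : ∀ (p : V[X]) (w : RatFunc K), p.natDegree ≤ f.natDegree →
      p.eval₂ ι w / f.eval₂ ι w ∈ IntR V K := fun p w hp d =>
    (ValuationSubring.valuation_le_one_iff (valuationSubringAt V K d) _).mp
      (Valuation.eval₂_div_eval₂_le_one _ ι (hι d) hf hp (hval d) w).2
  refine Subring.isPruferDomain_of_exists _ fun a b _ _ _ _ => ?_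
  have hne : f.eval₂ ι (a / b) ≠ 0 :=
    (Valuation.eval₂_div_eval₂_le_one _ ι (hι 0) hf le_rfl (hval 0) _).1
  have hdiv : f.divX.natDegree + 1 = f.natDegree := by
    rw [natDegree_divX_eq_natDegree_tsub_one]; omega
  -- From f = X·`f.divX` + f(0): all four numerators have degree at most that of f, so the quotients
  -- are integral at every d.
  refine ⟨f.divX.eval₂ ι (a / b) / f.eval₂ ι (a / b),
    ι (f.coeff 0) / f.eval₂ ι (a / b), ?_, ?_, ?_, ?_, ?_⟩
  · rw [div_mul_eq_mul_div, ← add_div, div_eq_one_iff_eq hne,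
      eval₂_eq_coeff_zero_add ι f (a / b)]
    ring
  · exact hmem _ _ (by omega)
  · simpa using hmem (C (f.coeff 0)) (a / b) (by simp)
  · rw [div_mul_eq_mul_div]
    simpa using hmem (f.divX * X) (a / b) (natDegree_mul_le.trans (by rw [natDegree_X]; omega))
  · rw [div_mul_eq_mul_div]
    simpa using hmem (C (f.coeff 0) * X) (a / b)
      ((natDegree_C_mul_le _ _).trans (by rw [natDegree_X]; omega))

theorem isPruferDomain_of_maximalIdeal_eq_span {t : V} (ht0 : t ≠ 0)
    (ht : IsLocalRing.maximalIdeal V = Ideal.span {t}) : IsPruferDomain (IntR V K) := by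
  have ht' : algebraMap V K t ≠ 0 :=
    (map_ne_zero_iff _ (IsFractionRing.injective V K)).mpr ht0
  have hC0 : RatFunc.C (algebraMap V K t) ≠ 0 := by simpa using ht'
  have hval : ∀ d, (valuationSubringAt V K d).valuation (RatFunc.C (algebraMap V K t)) < 1 :=
    fun d => valuation_lt_one_iff.mpr
      ⟨by simp, t, by rw [ht]; exact Ideal.mem_span_singleton_self t, by simp⟩
  have key := fun (d : V) (w : RatFunc K) =>
    Valuation.sq_sub_generator _ (hval d) hC0
      (fun x hx => valuation_le_of_maximalIdeal_eq_span ht0 ht hx) w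
  simp only [ValuationSubring.valuation_le_one_iff] at key
  refine Subring.isPruferDomain_of_exists _ fun a b _ _ _ _ => ?_
  refine ⟨a / b / ((a / b) ^ 2 - RatFunc.C (algebraMap V K t)),
    -RatFunc.C (algebraMap V K t) / ((a / b) ^ 2 - RatFunc.C (algebraMap V K t)), ?_,
    fun d => (key d _).2.1, fun d => (key d _).2.2.1, fun d => (key d _).2.2.2.1,
    fun d => (key d _).2.2.2.2⟩
  rw [div_mul_eq_mul_div, ← add_div, div_eq_one_iff_eq (key 0 _).1]
  ring

end IntR

/-! ### Elements of value close to that of a unit -/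

namespace ValuationRing

open Polynomial IsLocalRing Filter

section

variable {V : Type*} [CommRing V] [IsDomain V] [ValuationRing V]

/-- As no non-unit generates 𝔪, each is a product yz of two non-units. Splitting the cofactor e = yz
and keeping whichever of s, y divides the other raises the exponent by one. This makes `nearUnits` a
proper filter. -/
theorem exists_eq_pow_mul (hm : ¬ (maximalIdeal V).IsPrincipal) {c : V}
    (hc : c ∈ maximalIdeal V) (hc0 : c ≠ 0) (n : ℕ) :
    ∃ s ∈ maximalIdeal V, s ≠ 0 ∧ ∃ e ∈ maximalIdeal V, c = s ^ n * e := by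
  have hsplit : ∀ {x : V}, x ∈ maximalIdeal V →
      ∃ y ∈ maximalIdeal V, ∃ z ∈ maximalIdeal V, x = y * z := by
    intro x hx
    obtain ⟨y, hy, hyx⟩ : ∃ y ∈ maximalIdeal V, ¬ x ∣ y := by
      by_contra! hcon
      refine hm ⟨x, le_antisymm (fun y hy => ?_) ?_⟩
      · exact Ideal.mem_span_singleton.mpr (hcon y hy)
      · exact (Ideal.span_singleton_le_iff_mem _).mpr hx
    obtain ⟨z, rfl⟩ := (ValuationRing.dvd_total x y).resolve_left hyx
    refine ⟨y, hy, z, ?_, rfl⟩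
    rw [mem_maximalIdeal]
    intro hz
    exact hyx (hz.mul_right_dvd.mpr dvd_rfl)
  induction n with
  | zero => exact ⟨c, hc, hc0, c, hc, by simp⟩
  | succ n ih =>
    obtain ⟨s, hs, hs0, e, he, rfl⟩ := ih
    obtain ⟨y, hy, z, hz, rfl⟩ := hsplit he
    rcases ValuationRing.dvd_total s y with ⟨b, rfl⟩ | ⟨b, rfl⟩
    · exact ⟨s, hs, hs0, b * z, Ideal.mul_mem_left _ _ hz, by ring⟩
    · exact ⟨y, hy, left_ne_zero_of_mul hs0, b ^ n * z, Ideal.mul_mem_left _ _ hz, by ring⟩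

/-- For a non-principal maximal ideal, the filter of the nonzero non-units `s` whose values are
infinitesimally close to that of a unit: for every nonzero non-unit `c` and every `n`, eventually
`s ^ n` strictly divides `c`. -/
def nearUnits (hm : ¬ (maximalIdeal V).IsPrincipal) : Filter V where
  sets := {T | ∃ c ∈ maximalIdeal V, c ≠ 0 ∧ ∃ n : ℕ, ∀ s ∈ maximalIdeal V, s ≠ 0 →
    (∃ e ∈ maximalIdeal V, c = s ^ n * e) → s ∈ T}
  univ_sets := by
    obtain ⟨c, hc, hc0⟩ := Submodule.exists_mem_ne_zero_of_ne_bot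
      (show maximalIdeal V ≠ ⊥ by rintro h; exact hm (h ▸ inferInstance))
    exact ⟨c, hc, hc0, 0, fun _ _ _ _ => trivial⟩
  sets_of_superset := by
    rintro S T ⟨c, hc, hc0, n, h⟩ hST
    exact ⟨c, hc, hc0, n, fun s hs hs0 he => hST (h s hs hs0 he)⟩
  inter_sets := by
    rintro S T ⟨c, hc, hc0, n, h⟩ ⟨c', hc', hc0', n', h'⟩
    rcases ValuationRing.dvd_total c c' with ⟨x, rfl⟩ | ⟨x, rfl⟩
    · refine ⟨c, hc, hc0, n + n', fun s hs hs0 ⟨e, he, hce⟩ => ⟨h s hs hs0 ?_, h' s hs hs0 ?_⟩⟩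
      · exact ⟨s ^ n' * e, Ideal.mul_mem_left _ _ he, by rw [hce]; ring⟩
      · exact ⟨s ^ n * x * e, Ideal.mul_mem_left _ _ he, by rw [hce]; ring⟩
    · refine ⟨c', hc', hc0', n + n', fun s hs hs0 ⟨e, he, hce⟩ => ⟨h s hs hs0 ?_, h' s hs hs0 ?_⟩⟩
      · exact ⟨s ^ n' * x * e, Ideal.mul_mem_left _ _ he, by rw [hce]; ring⟩
      · exact ⟨s ^ n * e, Ideal.mul_mem_left _ _ he, by rw [hce]; ring⟩

variable (hm : ¬ (maximalIdeal V).IsPrincipal)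

instance nearUnits_neBot : (nearUnits hm).NeBot := by
  refine neBot_iff.mpr fun h => ?_
  have h0 : (∅ : Set V) ∈ nearUnits hm := by rw [h]; trivial
  obtain ⟨c, hc, hc0, n, h⟩ := h0
  obtain ⟨s, hs, hs0, he⟩ := exists_eq_pow_mul hm hc hc0 n
  exact h s hs hs0 he

theorem eventually_nearUnits_mem : ∀ᶠ s in nearUnits hm, s ∈ maximalIdeal V ∧ s ≠ 0 := by
  obtain ⟨c, hc, hc0⟩ := Submodule.exists_mem_ne_zero_of_ne_bot
    (show maximalIdeal V ≠ ⊥ by rintro h; exact hm (h ▸ inferInstance))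
  exact ⟨c, hc, hc0, 0, fun s hs hs0 _ => ⟨hs, hs0⟩⟩

theorem eventually_nearUnits_eq_pow_mul {c : V} (hc : c ∈ maximalIdeal V) (n : ℕ) :
    ∀ᶠ s in nearUnits hm, ∃ e ∈ maximalIdeal V, c = s ^ n * e := by
  by_cases hc0 : c = 0
  · exact Eventually.of_forall fun s => ⟨0, by simp, by simp [hc0]⟩
  · exact ⟨c, hc, hc0, n, fun s _ _ h => h⟩

theorem isUnit_add_of_mem {u e : V} (hu : IsUnit u) (he : e ∈ maximalIdeal V) :
    IsUnit (u + e) := by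
  by_contra h
  exact (((maximalIdeal V).add_mem_iff_left he).mp h) hu

/-- The coefficients below n are non-units, hence strictly divisible by high powers of s; the term
of degree n dominates. The induction strips off the constant term. -/
theorem eventually_eval_eq_pow_mul (n : ℕ) : ∀ {h : V[X]},
    (∀ i < n, h.coeff i ∈ maximalIdeal V) → IsUnit (h.coeff n) →
    ∀ᶠ s in nearUnits hm, ∃ u, IsUnit u ∧ h.eval s = s ^ n * u := by
  induction n with
  | zero =>
    intro h _ hn
    filter_upwards [eventually_nearUnits_mem hm] with s hs
    refine ⟨h.coeff 0 + s * h.divX.eval s,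
      isUnit_add_of_mem hn (Ideal.mul_mem_right _ _ hs.1), ?_⟩
    have := eval₂_eq_coeff_zero_add (RingHom.id V) h s
    rw [pow_zero, one_mul]
    exact this
  | succ n ih =>
    intro h hi hn
    filter_upwards [eventually_nearUnits_eq_pow_mul hm (hi 0 n.succ_pos) (n + 1),
      ih (h := h.divX) (fun i hin => by rw [coeff_divX]; exact hi _ (by omega))
        (by rwa [coeff_divX])] with s ⟨e, he, hes⟩ ⟨u, hu, hus⟩
    refine ⟨u + e, isUnit_add_of_mem hu he, ?_⟩
    have : h.eval s = h.coeff 0 + s * h.divX.eval s :=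
      eval₂_eq_coeff_zero_add (RingHom.id V) h s
    rw [this, hes, hus]
    ring

/-- The root multiplicity is the index of the first unit coefficient of the expansion at a. -/
theorem eventually_eval_add_eq_pow_mul {h : V[X]} (hh : h.map (residue V) ≠ 0) (a : V) :
    ∀ᶠ s in nearUnits hm, ∃ u, IsUnit u ∧
      h.eval (a + s) = s ^ ((h.map (residue V)).rootMultiplicity (residue V a)) * u := by
  have hmap : (h.comp (X + C a)).map (residue V) =
      (h.map (residue V)).comp (X + C (residue V a)) := by
    rw [Polynomial.map_comp]; simp
  have hne : (h.map (residue V)).comp (X + C (residue V a)) ≠ 0 := by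
    rwa [Ne, comp_X_add_C_eq_zero_iff]
  rw [rootMultiplicity_eq_natTrailingDegree, ← hmap]
  have := eventually_eval_eq_pow_mul hm
    ((h.comp (X + C a)).map (residue V)).natTrailingDegree (h := h.comp (X + C a))
    (fun i hi => ?_) ?_
  · filter_upwards [this] with s hs
    simpa [add_comm] using hs
  · rw [← residue_eq_zero_iff, ← coeff_map]
    exact coeff_eq_zero_of_lt_natTrailingDegree hi
  · rw [← residue_ne_zero_iff_isUnit, ← coeff_map]
    exact mt trailingCoeff_eq_zero.mp (hmap ▸ hne)

/-- Up to the factor s^N, the reflected polynomial gives h at 1/s; its first unit coefficient comes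
from the leading coefficient of the reduction. -/
theorem eventually_eval_reflect_eq_pow_mul {h : V[X]} (hh : h.map (residue V) ≠ 0) {N : ℕ}
    (hN : (h.map (residue V)).natDegree ≤ N) :
    ∀ᶠ s in nearUnits hm, ∃ u, IsUnit u ∧
      (reflect N h).eval s = s ^ (N - (h.map (residue V)).natDegree) * u := by
  refine eventually_eval_eq_pow_mul hm _ (fun i hi => ?_) ?_
  · rw [coeff_reflect, ← residue_eq_zero_iff, ← coeff_map, revAt_le (by omega)]
    exact coeff_eq_zero_of_natDegree_lt (by omega)
  · rw [coeff_reflect, ← residue_ne_zero_iff_isUnit, ← coeff_map, revAt_le (by omega),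
      Nat.sub_sub_self hN]
    exact mt leadingCoeff_eq_zero.mp hh

theorem le_of_pow_mul_eq {s u y : V} {i j : ℕ} (hs : s ∈ maximalIdeal V)
    (hs0 : s ≠ 0) (hu : IsUnit u) (h : s ^ i * u = s ^ j * y) : j ≤ i := by
  by_contra! hij
  obtain ⟨k, rfl⟩ := Nat.exists_eq_add_of_lt hij
  have h1 : u = s * (s ^ k * y) := by
    refine mul_left_cancel₀ (pow_ne_zero i hs0) ?_
    rw [h]; ring
  rw [h1] at hu
  exact hs (isUnit_of_mul_isUnit_left hu)

/-- A non-unit c would be divisible by s^(i+1) for s near the units, too much for s^i times a unit.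
-/
theorem isUnit_of_eventually {c : V} {i j : ℕ}
    (h : ∀ᶠ s in nearUnits hm, ∃ u y, IsUnit u ∧ s ^ i * u = c * (s ^ j * y)) : IsUnit c := by
  by_contra hc
  obtain ⟨s, ⟨hs, hs0⟩, ⟨u, y, hu, h1⟩, ⟨e, he, h2⟩⟩ := ((eventually_nearUnits_mem hm).and
    (h.and (eventually_nearUnits_eq_pow_mul hm hc (i + 1)))).exists
  have := le_of_pow_mul_eq (i := i) (j := i + 1) (y := e * (s ^ j * y)) hs hs0 hu
    (by rw [h1, h2]; ring)
  omega

/-- A quotient `f / g` of primitive polynomials cannot be integral on `V`, a non-unit on the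
maximal ideal, and a unit at elements of slightly negative value, if the residue field is
algebraically closed. -/
theorem false_of_eval_quotient [IsAlgClosed (ResidueField V)] {f g : V[X]} {N : ℕ}
    (hf : f.map (residue V) ≠ 0) (hg : g.map (residue V) ≠ 0)
    (hfN : f.natDegree ≤ N) (hgN : g.natDegree ≤ N) {α β : V} (hα : α ≠ 0) (hβ : β ≠ 0)
    (h1 : ∀ z, ∃ v, v * (β * g.eval z) = α * f.eval z)
    (h2 : ∀ s ∈ maximalIdeal V, ∃ v ∈ maximalIdeal V, v * (β * g.eval s) = α * f.eval s)
    (h3 : ∀ᶠ s in nearUnits hm, ∃ v, IsUnit v ∧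
      v * (β * (reflect N g).eval s) = α * (reflect N f).eval s) : False := by
  have hfN' : (f.map (residue V)).natDegree ≤ N := natDegree_map_le.trans hfN
  have hgN' : (g.map (residue V)).natDegree ≤ N := natDegree_map_le.trans hgN
  have hrf := eventually_eval_reflect_eq_pow_mul hm hf hfN'
  have hrg := eventually_eval_reflect_eq_pow_mul hm hg hgN'
  -- By `h3` the value of α/β is an integer multiple, with fixed coefficient, of that of every s
  -- near the units; only a unit allows this.
  obtain ⟨γ, hγ, hγ'⟩ : ∃ γ, IsUnit γ ∧ α = β * γ := by
    rcases ValuationRing.dvd_total β α with ⟨γ, rfl⟩ | ⟨γ, rfl⟩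
    · refine ⟨γ, isUnit_of_eventually hm
        (i := N - (g.map (residue V)).natDegree) (j := N - (f.map (residue V)).natDegree) ?_, rfl⟩
      filter_upwards [hrf, hrg, h3] with s ⟨u, hu, hfu⟩ ⟨w, hw, hgw⟩ ⟨v, hv, h⟩
      refine ⟨v * w, u, hv.mul hw, mul_left_cancel₀ hβ ?_⟩
      rw [hfu, hgw] at h
      linear_combination h
    · have hγ : IsUnit γ := by
        refine isUnit_of_eventually hm
          (i := N - (f.map (residue V)).natDegree) (j := N - (g.map (residue V)).natDegree) ?_
        filter_upwards [hrf, hrg, h3] with s ⟨u, hu, hfu⟩ ⟨w, hw, hgw⟩ ⟨v, hv, h⟩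
        refine ⟨u, v * w, hu, mul_left_cancel₀ hα ?_⟩
        rw [hfu, hgw] at h
        linear_combination -h
      obtain ⟨γ, rfl⟩ := hγ
      exact ⟨↑γ⁻¹, Units.isUnit _, by rw [mul_assoc, Units.mul_inv, mul_one]⟩
  obtain ⟨γ, rfl⟩ := hγ
  subst hγ'
  have hcancel : ∀ {v x y : V}, v * (β * x) = β * γ * y → ↑γ⁻¹ * v * x = y := by
    intro v x y h
    have h4 : v * x = γ * y := mul_left_cancel₀ hβ (by linear_combination h)
    rw [mul_assoc, h4, Units.inv_mul_cancel_left]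
  have hdeg : (f.map (residue V)).natDegree = (g.map (residue V)).natDegree := by
    obtain ⟨s, ⟨hs, hs0⟩, ⟨u, hu, hfu⟩, ⟨w, hw, hgw⟩, ⟨v, hv, h⟩⟩ :=
      ((eventually_nearUnits_mem hm).and (hrf.and (hrg.and h3))).exists
    have h := hcancel h
    rw [hfu, hgw] at h
    have ha := le_of_pow_mul_eq (y := ↑γ⁻¹ * v * w) hs hs0 hu (by rw [← h]; ring)
    have hb := le_of_pow_mul_eq (u := ↑γ⁻¹ * v * w) hs hs0
      (((Units.isUnit _).mul hv).mul hw) ((by rw [← h]; ring : _ = _ * u))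
    omega
  have hroot : ∀ a, (g.map (residue V)).rootMultiplicity (residue V a) ≤
      (f.map (residue V)).rootMultiplicity (residue V a) := by
    intro a
    obtain ⟨s, ⟨hs, hs0⟩, ⟨u, hu, hfu⟩, ⟨w, hw, hgw⟩⟩ :=
      ((eventually_nearUnits_mem hm).and ((eventually_eval_add_eq_pow_mul hm hf a).and
        (eventually_eval_add_eq_pow_mul hm hg a))).exists
    obtain ⟨v, h⟩ := h1 (a + s)
    have h := hcancel h
    rw [hfu, hgw] at h
    exact le_of_pow_mul_eq (y := ↑γ⁻¹ * v * w) hs hs0 hu (by rw [← h]; ring)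
  have hroot0 : (g.map (residue V)).rootMultiplicity 0 + 1 ≤
      (f.map (residue V)).rootMultiplicity 0 := by
    have hf0 := eventually_eval_add_eq_pow_mul hm hf 0
    have hg0 := eventually_eval_add_eq_pow_mul hm hg 0
    rw [map_zero] at hf0 hg0
    obtain ⟨s, ⟨hs, hs0⟩, ⟨u, hu, hfu⟩, ⟨w, hw, hgw⟩⟩ :=
      ((eventually_nearUnits_mem hm).and (hf0.and hg0)).exists
    rw [zero_add] at hfu hgw
    obtain ⟨v, hv, h⟩ := h2 s hs
    have h := hcancel h
    rw [hfu, hgw] at h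
    by_contra! hcon
    -- Without strict inequality, the non-unit v would divide the unit u.
    obtain ⟨k, hk⟩ := Nat.exists_eq_add_of_le (Nat.le_of_lt_succ hcon)
    rw [hk, pow_add] at h
    have h5 : u = ↑γ⁻¹ * v * (s ^ k * w) :=
      mul_left_cancel₀ (pow_ne_zero _ hs0) (by rw [← h]; ring)
    rw [h5] at hu
    exact hv (isUnit_of_mul_isUnit_right (isUnit_of_mul_isUnit_left hu))
  have hle : 0 ::ₘ (g.map (residue V)).roots ≤ (f.map (residue V)).roots := by
    classical
    rw [Multiset.le_iff_count]
    intro x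
    rw [Multiset.count_cons, count_roots, count_roots]
    split_ifs with hx
    · subst hx; exact hroot0
    · obtain ⟨a, rfl⟩ := residue_surjective x
      exact hroot a
  have hcard := Multiset.card_le_card hle
  rw [Multiset.card_cons, IsAlgClosed.card_roots_eq_natDegree,
    IsAlgClosed.card_roots_eq_natDegree] at hcard
  omega

end

/-- Divide by a coefficient of maximal value: all coefficients become integral and one becomes 1. -/
theorem exists_eq_C_mul_map_primitive (V : Type*) {K : Type*} [CommRing V] [IsDomain V]
    [ValuationRing V] [Field K] [Algebra V K] [IsFractionRing V K] {F : K[X]} (hF : F ≠ 0) :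
    ∃ (c : K) (f : V[X]), c ≠ 0 ∧ F = C c * f.map (algebraMap V K) ∧
      f.map (residue V) ≠ 0 := by
  obtain ⟨n, hn, hmax⟩ := F.support.exists_max_image
    (fun i => ValuationRing.valuation V K (F.coeff i)) (by simpa using hF)
  have hn0 : F.coeff n ≠ 0 := mem_support_iff.mp hn
  have hlift : C (F.coeff n)⁻¹ * F ∈ lifts (algebraMap V K) := by
    rw [lifts_iff_coeff_lifts]
    intro i
    rw [coeff_C_mul]
    apply (ValuationRing.mem_integer_iff V K _).mp
    rw [Valuation.mem_integer_iff, map_mul, map_inv₀]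
    by_cases hi : F.coeff i = 0
    · simp [hi]
    · have := hmax i (mem_support_iff.mpr hi)
      rw [inv_mul_le_iff₀ (zero_lt_iff.mpr ((Valuation.ne_zero_iff _).mpr hn0)), mul_one]
      exact this
  obtain ⟨f, hf⟩ := (mem_lifts _).mp hlift
  refine ⟨F.coeff n, f, hn0, ?_, fun h0 => ?_⟩
  · rw [hf, ← mul_assoc, ← C_mul, mul_inv_cancel₀ hn0, C_1, one_mul]
  · have h1 : f.coeff n = 1 := by
      apply IsFractionRing.injective V K
      rw [← coeff_map, hf, coeff_C_mul, inv_mul_cancel₀ hn0, map_one]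
    have h2 := congrArg (fun p => p.coeff n) h0
    simp [coeff_map, h1] at h2

end ValuationRing

/-! ### The field case and necessity -/

namespace IntR

open Polynomial IsLocalRing

variable {V K : Type*} [CommRing V] [IsDomain V] [Field K] [Algebra V K] [IsFractionRing V K]

theorem X_mem : RatFunc.X ∈ IntR V K := fun d => ⟨by simp, d, by simp⟩

theorem C_mem (c : V) : RatFunc.C (algebraMap V K c) ∈ IntR V K := fun _ => ⟨by simp, c, by simp⟩

theorem isPruferDomain_of_isField (h : IsField V) : IsPruferDomain (IntR V K) := by
  have hsurj : Function.Surjective (algebraMap V K) :=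
    IsFractionRing.surjective_iff_isField.mpr h
  have hmem : ∀ φ : RatFunc K, (∀ d : V, φ.denom.eval (algebraMap V K d) ≠ 0) → φ ∈ IntR V K :=
    fun φ hφ d => ⟨hφ d, (hsurj _).imp fun _ => Eq.symm⟩
  have hinv : ∀ φ ∈ IntR V K, algebraMap K[X] (RatFunc K) φ.denom ∈ IntR V K ∧
      (algebraMap K[X] (RatFunc K) φ.denom)⁻¹ ∈ IntR V K := by
    intro φ hφ
    refine ⟨hmem _ (by simp), hmem _ fun d => ?_⟩
    have := RatFunc.eval_div_of_ne_zero (p := 1) (hφ d).1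
    rw [map_one, one_div] at this
    exact this.1
  have hpoly : ∀ p : K[X], algebraMap K[X] (RatFunc K) p ∈ IntR V K :=
    fun p => hmem _ (by simp)
  refine Subring.isPruferDomain_of_exists _ fun a b ha hb ha0 hb0 => ?_
  have hinj := RatFunc.algebraMap_injective K
  classical
  obtain ⟨g, p, q, r, s, hg, hp, hq, hrs⟩ : ∃ g p q r s : K[X], g ≠ 0 ∧ a.num = g * p ∧
      b.num = g * q ∧ r * p + s * q = 1 := by
    have hg : EuclideanDomain.gcd a.num b.num ≠ 0 := by
      intro h0
      exact RatFunc.num_ne_zero ha0 (EuclideanDomain.gcd_eq_zero_iff.mp h0).1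
    obtain ⟨p, hp⟩ := EuclideanDomain.gcd_dvd_left a.num b.num
    obtain ⟨q, hq⟩ := EuclideanDomain.gcd_dvd_right a.num b.num
    refine ⟨_, p, q, EuclideanDomain.gcdA a.num b.num, EuclideanDomain.gcdB a.num b.num, hg,
      hp, hq, mul_left_cancel₀ hg ?_⟩
    have h := EuclideanDomain.gcd_eq_gcd_ab a.num b.num
    linear_combination (-1) * h - EuclideanDomain.gcdA a.num b.num * hp -
      EuclideanDomain.gcdB a.num b.num * hq
  have hda := hinv a ha
  have hdb := hinv b hb
  have hda0 : algebraMap K[X] (RatFunc K) a.denom ≠ 0 :=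
    (map_ne_zero_iff _ hinj).mpr a.denom_ne_zero
  have hdb0 : algebraMap K[X] (RatFunc K) b.denom ≠ 0 :=
    (map_ne_zero_iff _ hinj).mpr b.denom_ne_zero
  have hg' : algebraMap K[X] (RatFunc K) g ≠ 0 := (map_ne_zero_iff _ hinj).mpr hg
  have hq' : algebraMap K[X] (RatFunc K) q ≠ 0 := by
    refine (map_ne_zero_iff _ hinj).mpr ?_
    rintro rfl
    exact RatFunc.num_ne_zero hb0 (by simpa using hq)
  have hab : a / b = algebraMap K[X] (RatFunc K) p * (algebraMap K[X] (RatFunc K) a.denom)⁻¹ *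
      (algebraMap K[X] (RatFunc K) b.denom) / algebraMap K[X] (RatFunc K) q := by
    have h1 := RatFunc.num_div_denom a
    have h2 := RatFunc.num_div_denom b
    rw [hp, map_mul] at h1
    rw [hq, map_mul] at h2
    rw [div_eq_iff hda0] at h1
    rw [div_eq_iff hdb0] at h2
    field_simp
    linear_combination (-algebraMap K[X] (RatFunc K) q) * h1 + algebraMap K[X] (RatFunc K) p * h2
  have hrs' : algebraMap K[X] (RatFunc K) r * algebraMap K[X] (RatFunc K) p +
      algebraMap K[X] (RatFunc K) s * algebraMap K[X] (RatFunc K) q = 1 := by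
    rw [← map_mul, ← map_mul, ← map_add, hrs, map_one]
  set A := algebraMap K[X] (RatFunc K) a.denom
  set B := algebraMap K[X] (RatFunc K) b.denom
  -- Denominators A, B of members are units, and w = (p/q)(B/A) with rp + sq = 1. Hence e₁ = rqA/B
  -- gives e₁w = rp, and e₂ = sq.
  refine ⟨algebraMap K[X] (RatFunc K) r * algebraMap K[X] (RatFunc K) q * A * B⁻¹,
    algebraMap K[X] (RatFunc K) s * algebraMap K[X] (RatFunc K) q, ?_, ?_, ?_, ?_, ?_⟩
  · rw [hab, ← hrs']
    field_simp
  · exact mul_mem (mul_mem (mul_mem (hpoly _) (hpoly _)) hda.1) hdb.2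
  · exact mul_mem (hpoly _) (hpoly _)
  · have : algebraMap K[X] (RatFunc K) r * algebraMap K[X] (RatFunc K) q * A * B⁻¹ * (a / b) =
        algebraMap K[X] (RatFunc K) r * algebraMap K[X] (RatFunc K) p := by
      rw [hab]; field_simp
    rw [this]
    exact mul_mem (hpoly _) (hpoly _)
  · have : algebraMap K[X] (RatFunc K) s * algebraMap K[X] (RatFunc K) q * (a / b) =
        algebraMap K[X] (RatFunc K) s * algebraMap K[X] (RatFunc K) p * A⁻¹ * B := by
      rw [hab]; field_simp
    rw [this]
    exact mul_mem (mul_mem (mul_mem (hpoly _) (hpoly _)) hda.2) hdb.1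

/-- Invertibility of the ideal generated by the constant `t` and the indeterminate yields an
integer-valued rational function separating small from large values. -/
theorem exists_separating (h : IsPruferDomain (IntR V K)) {t : V} (ht : t ≠ 0) :
    ∃ φ : RatFunc K, ∀ d : V, φ.denom.eval (algebraMap V K d) ≠ 0 ∧ ∃ v b c : V,
      φ.num.eval (algebraMap V K d) = algebraMap V K v * φ.denom.eval (algebraMap V K d) ∧
      t * v = d * b ∧ d * (1 - v) = t * c := by
  let T : IntR V K := ⟨_, C_mem t⟩
  let Y : IntR V K := ⟨_, X_mem⟩
  have hT : T ≠ 0 := by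
    intro h0
    have h1 : RatFunc.C (algebraMap V K t) = 0 := congrArg Subtype.val h0
    exact ht (IsFractionRing.injective V K (by simpa using h1))
  have hne : Ideal.span {Y, T} ≠ ⊥ := by
    intro h0
    have : T ∈ Ideal.span {Y, T} := Ideal.subset_span (by simp)
    rw [h0] at this
    exact hT this
  obtain ⟨φ, ψ₁, ψ₂, h1, h2⟩ := Ideal.exists_of_isUnit_span_pair
    (h.isUnit_of_fg (Ideal.span {Y, T}) hne
      (Submodule.fg_span (Set.toFinite _)))
  refine ⟨φ, fun d => ⟨(φ.2 d).1, ?_⟩⟩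
  obtain ⟨v, hv⟩ := (φ.2 d).2
  obtain ⟨b, hb⟩ := (ψ₁.2 d).2
  obtain ⟨c, hc⟩ := (ψ₂.2 d).2
  have e1 := congrArg (fun x : IntR V K => x.1.eval (RingHom.id K) (algebraMap V K d)) h1
  -- The relation is rearranged without subtraction so that evaluation respects each operation.
  have h3 : Y * φ + T * ψ₂ = Y := by rw [← h2]; ring
  have e2 := congrArg (fun x : IntR V K => x.1.eval (RingHom.id K) (algebraMap V K d)) h3
  simp only [Subring.coe_mul, Subring.coe_add] at e1 e2
  rw [RatFunc.eval_mul _ _ (T.2 d).1 (φ.2 d).1, RatFunc.eval_mul _ _ (Y.2 d).1 (ψ₁.2 d).1,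
    hv, hb] at e1
  rw [RatFunc.eval_add (x := Y.1 * φ.1) (y := T.1 * ψ₂.1) _ _ ((Y * φ).2 d).1 ((T * ψ₂).2 d).1,
    RatFunc.eval_mul _ _ (Y.2 d).1 (φ.2 d).1, RatFunc.eval_mul _ _ (T.2 d).1 (ψ₂.2 d).1,
    hv, hc] at e2
  simp only [T, Y, RatFunc.eval_C, RatFunc.eval_X, RingHom.id_apply, ← map_mul, ← map_add]
    at e1 e2
  refine ⟨v, b, c, ?_, IsFractionRing.injective V K e1, ?_⟩
  · rw [← hv]
    exact (div_mul_cancel₀ _ (φ.2 d).1).symm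
  · linear_combination -(IsFractionRing.injective V K e2)

theorem not_isPruferDomain [ValuationRing V] [IsAlgClosed (ResidueField V)]
    (hm : ¬ (maximalIdeal V).IsPrincipal) : ¬ IsPruferDomain (IntR V K) := by
  intro hP
  have hinj := IsFractionRing.injective V K
  obtain ⟨t, ht, ht0⟩ := Submodule.exists_mem_ne_zero_of_ne_bot
    (show maximalIdeal V ≠ ⊥ by rintro h; exact hm (h ▸ inferInstance))
  have ht0' : algebraMap V K t ≠ 0 := (map_ne_zero_iff _ hinj).mpr ht0
  obtain ⟨φ, hφ⟩ := exists_separating hP ht0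
  have hsmall : ∀ s ∈ maximalIdeal V, ∀ v b : V, t * v = t * s * b → v ∈ maximalIdeal V := by
    intro s hs v b h
    have : v = s * b := mul_left_cancel₀ ht0 (by rw [h]; ring)
    rw [this]
    exact Ideal.mul_mem_right _ _ hs
  have hlarge : ∀ s ∈ maximalIdeal V, ∀ d v c : V, t = d * s → d * (1 - v) = t * c →
      IsUnit v := by
    rintro s hs d v c rfl h
    have h1 : 1 - v = s * c := mul_left_cancel₀ (left_ne_zero_of_mul ht0) (by rw [h]; ring)
    have h2 : v = 1 + -(s * c) := by rw [← h1]; ring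
    rw [h2]
    exact ValuationRing.isUnit_add_of_mem isUnit_one
      (neg_mem (Ideal.mul_mem_right _ _ hs))
  have hnum : φ.num ≠ 0 := by
    intro h0
    obtain ⟨h1, v, b, c, h2, -, h3⟩ := hφ 1
    have hv := hlarge t ht 1 v c (one_mul t).symm h3
    rw [h0, eval_zero, eq_comm, mul_eq_zero_iff_right h1] at h2
    exact hv.ne_zero (hinj (by rw [h2, map_zero]))
  have hscale : ∀ p : K[X], p ≠ 0 → p.comp (C (algebraMap V K t) * X) ≠ 0 := by
    intro p hp h0
    refine hp (Polynomial.ext fun n => ?_)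
    have h1 := congrArg (fun q => q.coeff n) h0
    rw [comp_C_mul_X_coeff, coeff_zero, mul_eq_zero_iff_right (pow_ne_zero n ht0')] at h1
    exact h1
  -- Rescaling x = ty moves the transition between small and large values to the units.
  obtain ⟨a, f, ha, hf, hf0⟩ := ValuationRing.exists_eq_C_mul_map_primitive V (hscale _ hnum)
  obtain ⟨b, g, hb, hg, hg0⟩ :=
    ValuationRing.exists_eq_C_mul_map_primitive V (hscale _ φ.denom_ne_zero)
  obtain ⟨α, β, hβ, hab⟩ := IsFractionRing.div_surjective (A := V) (a / b)
  have hβ0 : β ≠ 0 := nonZeroDivisors.ne_zero hβ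
  have hβ' : algebraMap V K β ≠ 0 := (map_ne_zero_iff _ hinj).mpr hβ0
  have hα0 : α ≠ 0 := by
    rintro rfl
    rw [map_zero, zero_div, eq_comm, div_eq_zero_iff] at hab
    tauto
  have hab' : algebraMap V K α * b = a * algebraMap V K β := by
    rwa [div_eq_div_iff hβ' hb] at hab
  -- Here y ranges over K, since y = s⁻¹ with d = t/s is needed as well as y ∈ V.
  have key : ∀ (y : K) (d v : V), algebraMap V K t * y = algebraMap V K d →
      φ.num.eval (algebraMap V K d) = algebraMap V K v * φ.denom.eval (algebraMap V K d) →
      algebraMap V K v * (algebraMap V K β * g.eval₂ (algebraMap V K) y) =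
        algebraMap V K α * f.eval₂ (algebraMap V K) y := by
    intro y d v hy h
    have hfy := congrArg (Polynomial.eval y) hf
    have hgy := congrArg (Polynomial.eval y) hg
    simp only [eval_comp, eval_mul, eval_C, eval_X, hy, eval_map] at hfy hgy
    rw [hfy, hgy] at h
    refine mul_left_cancel₀ hb ?_
    linear_combination (-algebraMap V K β) * h - f.eval₂ (algebraMap V K) y * hab'
  have key' : ∀ z v : V, φ.num.eval (algebraMap V K (t * z)) =
      algebraMap V K v * φ.denom.eval (algebraMap V K (t * z)) →
      v * (β * g.eval z) = α * f.eval z := by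
    intro z v h
    apply hinj
    have := key (algebraMap V K z) (t * z) v (by rw [map_mul]) h
    rw [eval₂_at_apply, eval₂_at_apply] at this
    simpa only [map_mul] using this
  refine ValuationRing.false_of_eval_quotient hm hf0 hg0
    (le_max_left f.natDegree g.natDegree) (le_max_right f.natDegree g.natDegree) hα0 hβ0
    (fun z => ?_) (fun s hs => ?_) ?_
  · obtain ⟨-, v, b, c, h, -, -⟩ := hφ (t * z)
    exact ⟨v, key' z v h⟩
  · obtain ⟨-, v, b, c, h, h1, -⟩ := hφ (t * s)
    exact ⟨v, hsmall s hs v b h1, key' s v h⟩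
  · filter_upwards [ValuationRing.eventually_nearUnits_mem hm,
      ValuationRing.eventually_nearUnits_eq_pow_mul hm ht 1] with s ⟨hs, hs0⟩ ⟨d, _, hd⟩
    rw [pow_one, mul_comm] at hd
    obtain ⟨-, v, b, c, h, -, h1⟩ := hφ d
    refine ⟨v, hlarge s hs d v c hd h1, hinj ?_⟩
    have hs0' : algebraMap V K s ≠ 0 := (map_ne_zero_iff _ hinj).mpr hs0
    have hy : algebraMap V K t * (algebraMap V K s)⁻¹ = algebraMap V K d := by
      rw [hd, map_mul, mul_inv_cancel_right₀ hs0']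
    have h2 := key _ d v hy h
    let := invertibleOfNonzero (inv_ne_zero hs0')
    have hr : ∀ p : V[X], p.natDegree ≤ max f.natDegree g.natDegree →
        algebraMap V K ((reflect (max f.natDegree g.natDegree) p).eval s) *
          (algebraMap V K s)⁻¹ ^ max f.natDegree g.natDegree =
        p.eval₂ (algebraMap V K) (algebraMap V K s)⁻¹ := by
      intro p hp
      have := eval₂_reflect_mul_pow (algebraMap V K) (algebraMap V K s)⁻¹ _ p hp
      rwa [invOf_eq_inv, inv_inv, eval₂_at_apply] at this
    rw [← hr f (le_max_left _ _), ← hr g (le_max_right _ _)] at h2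
    refine mul_right_cancel₀ (pow_ne_zero (max f.natDegree g.natDegree) (inv_ne_zero hs0')) ?_
    simp only [map_mul]
    linear_combination h2

end IntR

theorem mainTheorem2 (V K : Type*) [CommRing V] [IsDomain V] [ValuationRing V]
    [Field K] [Algebra V K] [IsFractionRing V K] :
    IsPruferDomain (IntR V K) ↔
      (¬ IsAlgClosed (IsLocalRing.ResidueField V) ∨
        (IsLocalRing.maximalIdeal V).IsPrincipal) := by
  constructor
  · intro h
    by_contra! hcon
    obtain ⟨h1, h2⟩ := hcon
    exact IntR.not_isPruferDomain h2 h
  · rintro (h | ⟨t, ht⟩)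
    · exact IntR.isPruferDomain_of_not_isAlgClosed h
    -- The zero ideal is principal too; then V is a field and w² - t gives nothing.
    · by_cases ht0 : t = 0
      · subst ht0
        exact IntR.isPruferDomain_of_isField
          (IsLocalRing.isField_iff_maximalIdeal_eq.mpr (by simpa using ht))
      · exact IntR.isPruferDomain_of_maximalIdeal_eq_span ht0 ht
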